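/- **Setting.** Let $n\ge 1$ and let $\mathcal G$ be a simple weighted directed graph on the vertices $1,\dots,n$ with adjacency matrix $(a_{ij})$: $a_{ij}>0$ if there is an edge from $j$ (parent) to $i$ (child), $a_{ij}=0$ otherwise, and there are no loops. A directed spanning tree of $\mathcal G$ is a set of edges of $\mathcal G$ such that, using these edges only, one vertex (the root) has no parent, every other vertex has exactly one parent, and there is a directed path from the root to every vertex. A dual quaternion is $h+\varepsilon h'$ with $h,h'\in\mathbb H$ and $\varepsilon^2=0$, where $\varepsilon$ commutes with $\mathbb H$; its conjugate is $h^*+\varepsilon h'^*$. Let $\mathcal S$ be the set of unit dual quaternions ($x x^*=1$). Each $x\in\mathcal S$ is $x=r+\tfrac12\varepsilon\,p\,r$ with $r$ a unit quaternion (rotation) and $p=2x'r^*$ a pure quaternion (translation), where $x'$ is the coefficient of $\varepsilon$. If $r\ne-1$, write $r=\cos(\phi/2)+\sin(\phi/2)\,\mathbf n$ with $\phi\in[0,2\pi)$ and $\mathbf n$ a pure unit quaternion, and put $\log r=\tfrac{\phi}{2}\mathbf n$ and $\log x=\tfrac12(\phi\,\mathbf n+\varepsilon p)$; the logarithm is not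 defined for $r=-1$. Let $\mathrm{vec}_4,\mathrm{vec}_8$ (resp. $\mathrm{vec}_3,\mathrm{vec}_6$) list the coefficients of a quaternion and a dual quaternion (resp. a pure one), and let $H_4^{\pm},H_8^-$ be the matrices with $\mathrm{vec}_4(gh)=H_4^+(g)\,\mathrm{vec}_4h=H_4^-(h)\,\mathrm{vec}_4g$ and $\mathrm{vec}_8(gh)=H_8^-(h)\,\mathrm{vec}_8g$. Let $$Q_8(x)=\begin{bmatrix}Q(r)&0\\ \tfrac12H_4^+(p)Q(r)&H_4^-(r)Q_p\end{bmatrix}\in\mathbb R^{8\times6},\qquad Q_p=\begin{bmatrix}0_{1\times 3}\\ I_3\end{bmatrix},$$ where $Q(r)=\partial\,\mathrm{vec}_4r/\partial\,\mathrm{vec}_3y$ is the Jacobian matrix of $y\mapsto r=\exp y$ on pure quaternions, taken at $y=\log r$. **Theorem.** Let $\delta_1,\dots,\delta_n\in\mathcal S$ be constant (the desired poses relative to the center of formation). The agents have poses $x_i(t)\in\mathcal S$ with kinematics $\mathrm{vec}_8\dot x_i=\mathrm{vec}_8u_i$; put $x_{c,i}=x_i\delta_i^*$, with output $y_{c,i}=\log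 x_{c,i}$. Consider the protocol $$\mathrm{vec}_8u_i=-H_8^-(\delta_i)\,Q_8(x_{c,i})\sum_{j=1}^na_{ij}\,\mathrm{vec}_6(y_{c,i}-y_{c,j}),\qquad i=1,\dots,n.$$ Call a configuration $(x_1,\dots,x_n)\in\mathcal S^n$ admissible if all $\log x_{c,i}$ are defined, that is, no $x_{c,i}$ has rotation part $-1$. A trajectory is a solution of the closed-loop system on $[0,\infty)$ through admissible configurations. Then: 1. From every admissible initial configuration there starts a trajectory. 2. The agents asymptotically reach the desired formation along every trajectory (that is, for every trajectory there is $x_c\in\mathcal S$ with $\lim_{t\to\infty}x_i(t)=x_c\,\delta_i$ for all $i$) if and only if $\mathcal G$ has a directed spanning tree. 3. The outputs achieve consensus along every trajectory (that is, $\lim_{t\to\infty}(y_{c,i}(t)-y_{c,j}(t))=0$ for all $i,j$) if and only if $\mathcal G$ has a directed spanning tree. -/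

import Mathlib

open Filter Topology
open scoped Quaternion

noncomputable section

namespace PoseFormation

/-! ### Weighted directed graphs and directed spanning trees -/

/-- A simple weighted directed graph on the vertices `Fin n`. `Adj j i` says that there is an edge
from the parent `j` to the child `i`; `weight i j` is the entry `a_ij` of the adjacency matrix,
which is positive if there is an edge from `j` to `i`, and zero otherwise. -/
structure WeightedDigraph (n : ℕ) extends Digraph (Fin n) where
  /-- the adjacency matrix -/
  weight : Matrix (Fin n) (Fin n) ℝ
  loopless : ∀ i, ¬ Adj i i
  weight_pos : ∀ i j, Adj j i → 0 < weight i j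
  weight_eq_zero : ∀ i j, ¬ Adj j i → weight i j = 0

/-- A directed tree: a root `r` without parents, every other vertex has exactly one parent,
and there is a directed path from the root to every vertex. -/
def IsDirectedTree {V : Type*} (T : Digraph V) : Prop :=
  ∃ r : V, (∀ u, ¬ T.Adj u r) ∧ (∀ v, v ≠ r → ∃! u, T.Adj u v) ∧
    ∀ v, Relation.ReflTransGen T.Adj r v

/-- Some subset of the edges forms a directed tree on all the vertices. -/
def HasDirectedSpanningTree {V : Type*} (G : Digraph V) : Prop :=
  ∃ T : Digraph V, T ≤ G ∧ IsDirectedTree T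

/-! ### Quaternions -/

/-- The four coefficients of a quaternion. -/
def vec4 (h : ℍ[ℝ]) : Fin 4 → ℝ := ![h.re, h.imI, h.imJ, h.imK]

/-- The three coefficients of a pure quaternion. -/
def vec3 (h : ℍ[ℝ]) : Fin 3 → ℝ := ![h.imI, h.imJ, h.imK]

/-- The pure quaternion with given coefficients. -/
def pure3 (v : Fin 3 → ℝ) : ℍ[ℝ] := ⟨0, v 0, v 1, v 2⟩

/-- The Hamilton operator `H⁺₄`, that is, left multiplication. -/
def hamPlus4 (h : ℍ[ℝ]) : Matrix (Fin 4) (Fin 4) ℝ :=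
  !![h.re, -h.imI, -h.imJ, -h.imK;
     h.imI, h.re, -h.imK, h.imJ;
     h.imJ, h.imK, h.re, -h.imI;
     h.imK, -h.imJ, h.imI, h.re]

/-- The Hamilton operator `H⁻₄`, that is, right multiplication. -/
def hamMinus4 (h : ℍ[ℝ]) : Matrix (Fin 4) (Fin 4) ℝ :=
  !![h.re, -h.imI, -h.imJ, -h.imK;
     h.imI, h.re, h.imK, -h.imJ;
     h.imJ, -h.imK, h.re, h.imI;
     h.imK, h.imJ, -h.imI, h.re]

/-- The logarithm `(φ/2) n` of a unit quaternion `r = cos (φ/2) + sin (φ/2) n`, where `n` is a pure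
unit quaternion and `0 ≤ φ < 2π`. It is meaningful for unit quaternions `r ≠ -1`. -/
def qlog (r : ℍ[ℝ]) : ℍ[ℝ] := Real.arccos r.re • (‖r.im‖⁻¹ • r.im)

theorem qlog_cos_add_sin {φ : ℝ} (h0 : 0 ≤ φ) (h1 : φ < 2 * Real.pi) {n : ℍ[ℝ]}
    (hn : n.re = 0) (hn1 : ‖n‖ = 1) :
    qlog ((Real.cos (φ / 2) : ℍ[ℝ]) + Real.sin (φ / 2) • n) = (φ / 2) • n := by
  have hnim : n.im = n := by ext <;> simp [hn]
  have him : ((Real.cos (φ / 2) : ℍ[ℝ]) + Real.sin (φ / 2) • n).im = Real.sin (φ / 2) • n := by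
    ext <;> simp [hn]
  have hre : ((Real.cos (φ / 2) : ℍ[ℝ]) + Real.sin (φ / 2) • n).re = Real.cos (φ / 2) := by
    simp [hn]
  have hs : 0 ≤ Real.sin (φ / 2) := Real.sin_nonneg_of_nonneg_of_le_pi (by linarith) (by linarith)
  rw [qlog, him, hre, Real.arccos_cos (by linarith) (by linarith), norm_smul, hn1,
    Real.norm_of_nonneg hs, mul_one, smul_smul]
  rcases eq_or_lt_of_le h0 with h | h
  · simp [← h]
  · have : 0 < Real.sin (φ / 2) := Real.sin_pos_of_pos_of_lt_pi (by linarith) (by linarith)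
    rw [smul_smul, mul_assoc, inv_mul_cancel₀ this.ne', mul_one]

/-- `Q(r) = ∂ vec₄ r / ∂ vec₃ y` with `y = log r`: the Jacobian matrix at `log r` of
the exponential map `y ↦ exp y` from pure quaternions to unit quaternions. -/
def Q (r : ℍ[ℝ]) : Matrix (Fin 4) (Fin 3) ℝ :=
  LinearMap.toMatrix'
    (fderiv ℝ (fun v : Fin 3 → ℝ => vec4 (NormedSpace.exp (pure3 v))) (vec3 (qlog r))).toLinearMap

/-- The matrix `[0; I₃]`. -/
def Qp : Matrix (Fin 4) (Fin 3) ℝ :=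
  !![0, 0, 0;
     1, 0, 0;
     0, 1, 0;
     0, 0, 1]

/-! ### Dual quaternions `h + ε h'`, with `h = x.fst` and `h' = x.snd`

The coordinates of `ℝ⁸` are indexed by `Fin 4 ⊕ Fin 4`, and those of `ℝ⁶` by `Fin 3 ⊕ Fin 3`. -/

/-- Dual quaternions. -/
abbrev DualQuat : Type := DualNumber ℍ[ℝ]

/-- The conjugate of a dual quaternion. -/
def conj (x : DualQuat) : DualQuat :=
  TrivSqZeroExt.inl (star x.fst) + TrivSqZeroExt.inr (star x.snd)

/-- Unit dual quaternions: those of norm `√(x x*) = 1`. -/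
def IsUnitDualQuat (x : DualQuat) : Prop := x * conj x = 1

/-- The eight coefficients of a dual quaternion. -/
def vec8 (x : DualQuat) : Fin 4 ⊕ Fin 4 → ℝ := Sum.elim (vec4 x.fst) (vec4 x.snd)

/-- The six coefficients of a pure dual quaternion. -/
def vec6 (x : DualQuat) : Fin 3 ⊕ Fin 3 → ℝ := Sum.elim (vec3 x.fst) (vec3 x.snd)

/-- The Hamilton operator `H⁻₈`, that is, right multiplication. -/
def hamMinus8 (x : DualQuat) : Matrix (Fin 4 ⊕ Fin 4) (Fin 4 ⊕ Fin 4) ℝ :=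
  Matrix.fromBlocks (hamMinus4 x.fst) 0 (hamMinus4 x.snd) (hamMinus4 x.fst)

/-- The translation `p = 2 r' r*` of a unit dual quaternion `x = r + ε r' = r + ε (1/2) p r`. -/
def translation (x : DualQuat) : ℍ[ℝ] := (2 : ℝ) • (x.snd * star x.fst)

/-- The logarithm `(1/2) (φ n + ε p)` of a unit dual quaternion `x = r + ε (1/2) p r`,
where `r = cos (φ/2) + sin (φ/2) n`. -/
def dqlog (x : DualQuat) : DualQuat :=
  TrivSqZeroExt.inl (qlog x.fst) + TrivSqZeroExt.inr ((1 / 2 : ℝ) • translation x)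

/-- The domain of the logarithm: the rotation part is of the form `cos (φ/2) + sin (φ/2) n` with
`0 ≤ φ < 2π`, which excludes precisely `-1`. -/
def InLogDomain (x : DualQuat) : Prop := IsUnitDualQuat x ∧ x.fst ≠ -1

/-- The matrix `Q₈(x)` with `vec₈ ẋ = Q₈(x) vec₆ ẏ` for `y = log x`. -/
def Q8 (x : DualQuat) : Matrix (Fin 4 ⊕ Fin 4) (Fin 3 ⊕ Fin 3) ℝ :=
  Matrix.fromBlocks (Q x.fst) 0
    ((1 / 2 : ℝ) • (hamPlus4 (translation x) * Q x.fst)) (hamMinus4 x.fst * Qp)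

/-! ### The multi-agent system -/

variable {n : ℕ}

/-- The opinion `x_{c,i} = x_i δ_i*` of agent `i` on the center of formation. -/
def center (δ x : Fin n → DualQuat) (i : Fin n) : DualQuat := x i * conj (δ i)

/-- The output `y_{c,i} = log x_{c,i}` of agent `i`. -/
def output (δ x : Fin n → DualQuat) (i : Fin n) : DualQuat := dqlog (center δ x i)

/-- The consensus protocol: `vec₈ u_i` as a function of the poses `x` of all agents. -/
def protocol (G : WeightedDigraph n) (δ x : Fin n → DualQuat) (i : Fin n) : Fin 4 ⊕ Fin 4 → ℝ :=
  -((hamMinus8 (δ i) * Q8 (center δ x i)).mulVec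
      (∑ j, G.weight i j • vec6 (output δ x i - output δ x j)))

/-- A configuration of the agents: all poses are unit dual quaternions, and all outputs are
defined. -/
def IsConfiguration (δ x : Fin n → DualQuat) : Prop :=
  ∀ i, IsUnitDualQuat (x i) ∧ InLogDomain (center δ x i)

/-- A trajectory on `[0, ∞)` of the closed-loop system `vec₈ ẋ_i = vec₈ u_i`
(with a one-sided derivative at time `0`). -/
def IsTrajectory (G : WeightedDigraph n) (δ : Fin n → DualQuat)
    (x : ℝ → Fin n → DualQuat) : Prop :=
  ∀ t, 0 ≤ t → IsConfiguration δ (x t) ∧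
    ∀ i, HasDerivWithinAt (fun s => vec8 (x s i)) (protocol G δ (x t) i) (Set.Ici 0) t

/-- The outputs asymptotically achieve consensus along `x`. -/
def OutputConsensus (δ : Fin n → DualQuat) (x : ℝ → Fin n → DualQuat) : Prop :=
  ∀ i j, Tendsto (fun t => output δ (x t) i - output δ (x t) j) atTop (𝓝 0)

/-- The agents asymptotically reach the desired formation along `x`: for some pose `x_c` of the
center of formation, the pose of every agent `i` tends to `x_c δ_i`. -/
def ReachesFormation (δ : Fin n → DualQuat) (x : ℝ → Fin n → DualQuat) : Prop :=
  ∃ xc : DualQuat, IsUnitDualQuat xc ∧ ∀ i, Tendsto (fun t => x t i) atTop (𝓝 (xc * δ i))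

end PoseFormation

end

/-!
The logarithms `yᵢ = log (xᵢ δᵢ*)` of the opinions on the center of formation linearize the closed
loop. The matrix `Q₈(x)` is the differential of the exponential map at `log x`, and `H₈⁻(δᵢ)` is
right multiplication by `δᵢ`, so the protocol prescribes exactly the velocity
`ẏᵢ = -∑ⱼ aᵢⱼ (yᵢ - yⱼ)` (`protocol_eq`). That this velocity of the pose really is the velocity of
the logarithm is `hasDerivWithinAt_logPair`; its only delicate point is the smoothness of `log` at
rotation `1` (`hasDerivWithinAt_qlog`). So along every trajectory `y(t) = exp(-tL) y(0)`, where `L`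
is the graph Laplacian (`IsTrajectory.logState_eq_flow`).

The matrices `exp(-tL)`, `t ≥ 0`, are row stochastic. Hence the rotation vectors stay
in the ball of radius less than `π` that contains the initial ones, where `exp` and `log` are
inverse to each other, and exponentials of solutions of the linear equation are trajectories
(`isTrajectory_dexp_flow`). This gives existence.

If the graph has a directed spanning tree, then the column of `exp(-L)` belonging to the root is
positive, so that one unit of time contracts the diameter of the family `y` by a fixed factor; all
`yᵢ` tend to a common limit (`exists_tendsto_flow`), and by continuity of the exponential the poses
tend to the formation. If it has none, then there are two disjoint nonempty sets of vertices that
no edge enters (`exists_disjoint_closed_of_not_hasDirectedSpanningTree`). Outputs that are constant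
on each of them remain so, and two different constants contradict consensus and formation
(`exists_isTrajectory_constant`).
-/

namespace PoseFormation

/-! ### Directed spanning trees and roots -/

/-- There is a walk with `k` edges from `r` to `v`. -/
def IsWalkEnd {V : Type*} (G : Digraph V) (r : V) : ℕ → V → Prop
  | 0, v => v = r
  | k + 1, v => ∃ u, IsWalkEnd G r k u ∧ G.Adj u v

/-- A vertex from which all vertices can be reached is the root of a breadth-first spanning
tree. -/
theorem hasDirectedSpanningTree_of_root {V : Type*} {G : Digraph V} {r : V}
    (hr : ∀ v, Relation.ReflTransGen G.Adj r v) : HasDirectedSpanningTree G := by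
  classical
  have hex (v : V) : ∃ k, IsWalkEnd G r k v := by
    induction hr v with
    | refl => exact ⟨0, rfl⟩
    | @tail u v _ huv ih =>
      obtain ⟨k, hk⟩ := ih
      exact ⟨k + 1, u, hk, huv⟩
  -- `d` is the distance from the root, and `par v` a neighbor of `v` one step closer to it.
  let d : V → ℕ := fun v => Nat.find (hex v)
  have hpar (v) (hv : v ≠ r) : ∃ u, G.Adj u v ∧ d u < d v := by
    have h := Nat.find_spec (hex v)
    rcases hd : Nat.find (hex v) with _ | k
    · rw [hd] at h
      exact absurd h hv
    · rw [hd] at h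
      obtain ⟨u, hu, huv⟩ := h
      refine ⟨u, huv, ?_⟩
      have : d u ≤ k := Nat.find_min' _ hu
      have : d v = k + 1 := hd
      omega
  choose! par hadj hlt using hpar
  refine ⟨⟨fun u v => v ≠ r ∧ u = par v⟩, ?_, r, ?_, ?_, ?_⟩
  · rintro u v ⟨hv, rfl⟩
    exact hadj v hv
  · exact fun u hu => hu.1 rfl
  · exact fun v hv => ⟨par v, ⟨hv, rfl⟩, fun u hu => hu.2⟩
  · have key (k : ℕ) : ∀ v, d v = k →
        Relation.ReflTransGen (fun u v => v ≠ r ∧ u = par v) r v := by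
      induction k using Nat.strong_induction_on with
      | _ k ih =>
        intro v hk
        rcases eq_or_ne v r with rfl | hv
        · exact .refl
        · exact (ih _ (hk ▸ hlt v hv) _ rfl).tail ⟨hv, rfl⟩
    exact fun v => key _ v rfl

theorem HasDirectedSpanningTree.exists_root {V : Type*} {G : Digraph V}
    (h : HasDirectedSpanningTree G) : ∃ r, ∀ v, Relation.ReflTransGen G.Adj r v := by
  obtain ⟨T, hT, r, -, -, hr⟩ := h
  exact ⟨r, fun v => Relation.ReflTransGen.mono (fun _ _ h => hT h) _ _ (hr v)⟩

/-- A finite digraph without a directed spanning tree has two disjoint nonempty sets of vertices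
that no edge enters. They are the sets of ancestors of two vertices: `v` with as few ancestors as
possible, and `w` not reachable from `v`. -/
theorem exists_disjoint_closed_of_not_hasDirectedSpanningTree {V : Type*} [Finite V] [Nonempty V]
    {G : Digraph V} (h : ¬ HasDirectedSpanningTree G) :
    ∃ S T : Set V, S.Nonempty ∧ T.Nonempty ∧ Disjoint S T ∧
      (∀ i ∈ S, ∀ j, G.Adj j i → j ∈ S) ∧ (∀ i ∈ T, ∀ j, G.Adj j i → j ∈ T) := by
  let anc : V → Set V := fun v => {u | Relation.ReflTransGen G.Adj u v}
  have hclosed (v) : ∀ i ∈ anc v, ∀ j, G.Adj j i → j ∈ anc v := fun i hi j hj =>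
    Relation.ReflTransGen.head hj hi
  obtain ⟨v, hv⟩ := Finite.exists_min fun v => (anc v).ncard
  obtain ⟨w, hw⟩ : ∃ w, ¬ Relation.ReflTransGen G.Adj v w := by
    by_contra! hall
    exact h (hasDirectedSpanningTree_of_root hall)
  refine ⟨anc v, anc w, ⟨v, .refl⟩, ⟨w, .refl⟩, ?_, hclosed v, hclosed w⟩
  rw [Set.disjoint_left]
  intro z hzv hzw
  have hsub : anc z ⊆ anc v := fun u hu => Relation.ReflTransGen.trans hu hzv
  -- By minimality of `v`, the ancestors of its ancestor `z` include `v` itself.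
  have heq : anc z = anc v := Set.eq_of_subset_of_ncard_le hsub (hv z) (Set.toFinite _)
  have hvz : v ∈ anc z := heq ▸ Relation.ReflTransGen.refl
  exact hw (Relation.ReflTransGen.trans hvz hzw)

/-! ### Matrices acting on families of vectors -/

section Averaging

variable {ι F : Type*} [Fintype ι] [NormedAddCommGroup F] [NormedSpace ℝ F]

/-- A real matrix acting on a family of vectors, `(P y)ᵢ = ∑ⱼ Pᵢⱼ yⱼ`. -/
noncomputable def act (P : Matrix ι ι ℝ) (y : ι → F) (i : ι) : F := ∑ j, P i j • y j

theorem act_mul (P R : Matrix ι ι ℝ) (y : ι → F) : act (P * R) y = act P (act R y) := by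
  ext i
  simp only [act, Matrix.mul_apply, Finset.sum_smul, Finset.smul_sum, smul_smul]
  exact Finset.sum_comm

variable [DecidableEq ι]

theorem act_one (y : ι → F) : act 1 y = y := by
  ext i
  simp [act, Matrix.one_apply, ite_smul]

theorem act_sub_const {P : Matrix ι ι ℝ} (hP : P ∈ Matrix.rowStochastic ℝ ι) (y : ι → F) (i : ι)
    (c : F) : act P y i - c = ∑ j, P i j • (y j - c) := by
  simp [act, smul_sub, Finset.sum_sub_distrib, ← Finset.sum_smul,
    Matrix.sum_row_of_mem_rowStochastic hP]

/-- Averages stay in balls. -/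
theorem norm_act_sub_le {P : Matrix ι ι ℝ} (hP : P ∈ Matrix.rowStochastic ℝ ι) {y : ι → F}
    {c : F} {D : ℝ} (hD : ∀ j, ‖y j - c‖ ≤ D) (i : ι) : ‖act P y i - c‖ ≤ D := by
  rw [act_sub_const hP]
  calc ‖∑ j, P i j • (y j - c)‖ ≤ ∑ j, P i j * D := by
        refine norm_sum_le_of_le _ fun j _ => ?_
        have h0 := Matrix.nonneg_of_mem_rowStochastic hP (i := i) (j := j)
        rw [norm_smul, Real.norm_of_nonneg h0]
        exact mul_le_mul_of_nonneg_left (hD j) h0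
    _ = D := by rw [← Finset.sum_mul, Matrix.sum_row_of_mem_rowStochastic hP, one_mul]

/-- If all rows of a stochastic matrix put weight at least `1 - s` on one common column, then
averaging contracts the diameter of a family by the factor `s`: the part of the weights in common
cancels in differences. -/
theorem norm_act_sub_act_le {P : Matrix ι ι ℝ} (hP : P ∈ Matrix.rowStochastic ℝ ι) {r : ι}
    {s : ℝ} (hs : 0 < s) (hr : ∀ i, 1 - s ≤ P i r) {y : ι → F} {D : ℝ}
    (hD : ∀ i j, ‖y i - y j‖ ≤ D) (i j : ι) : ‖act P y i - act P y j‖ ≤ s * D := by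
  -- `R` is what remains of `P` when the common weight `1 - s` on column `r` is removed.
  let R : ι → ι → ℝ := fun i k => P i k - if k = r then 1 - s else 0
  have hR0 (i k) : 0 ≤ R i k := by
    by_cases hk : k = r
    · subst hk; simpa [R] using hr i
    · simpa [R, hk] using Matrix.nonneg_of_mem_rowStochastic hP
  have hR1 (i) : ∑ k, R i k = s := by
    simp [R, Finset.sum_sub_distrib, Matrix.sum_row_of_mem_rowStochastic hP]
  have hRP (i) : ∑ k, R i k • y k = act P y i - (1 - s) • y r := by
    simp [R, act, sub_smul, Finset.sum_sub_distrib, ite_smul]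
  have key : s • (act P y i - act P y j) = ∑ k, ∑ l, (R i k * R j l) • (y k - y l) := by
    have h1 : ∑ k, ∑ l, (R i k * R j l) • y k = s • ∑ k, R i k • y k := by
      rw [Finset.smul_sum]
      refine Finset.sum_congr rfl fun k _ => ?_
      rw [← Finset.sum_smul, ← Finset.mul_sum, hR1, mul_comm, smul_smul]
    have h2 : ∑ k, ∑ l, (R i k * R j l) • y l = s • ∑ l, R j l • y l := by
      rw [Finset.sum_comm, Finset.smul_sum]
      refine Finset.sum_congr rfl fun k _ => ?_
      rw [← Finset.sum_smul, ← Finset.sum_mul, hR1, smul_smul]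
    simp only [smul_sub (_ * _), Finset.sum_sub_distrib]
    rw [h1, h2, hRP, hRP, ← smul_sub]
    congr 1
    abel
  have : s * ‖act P y i - act P y j‖ ≤ s * (s * D) := by
    calc s * ‖act P y i - act P y j‖ = ‖s • (act P y i - act P y j)‖ := by
          rw [norm_smul, Real.norm_of_nonneg hs.le]
      _ ≤ ∑ k, ∑ l, (R i k * R j l) * D := by
          rw [key]
          refine norm_sum_le_of_le _ fun k _ => norm_sum_le_of_le _ fun l _ => ?_
          rw [norm_smul, Real.norm_of_nonneg (mul_nonneg (hR0 _ _) (hR0 _ _))]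
          exact mul_le_mul_of_nonneg_left (hD k l) (mul_nonneg (hR0 _ _) (hR0 _ _))
      _ = s * (s * D) := by
          simp only [← Finset.sum_mul, ← Finset.mul_sum, hR1]
          ring
  exact le_of_mul_le_mul_left this hs

end Averaging

/-! ### Exponentials of Laplacian-type matrices -/

section MatrixExp

open scoped Matrix.Norms.Operator

variable {ι : Type*} [Fintype ι] [DecidableEq ι]

theorem hasSum_matrix_exp_apply (A : Matrix ι ι ℝ) (i j : ι) :
    HasSum (fun k : ℕ => ((k.factorial : ℝ)⁻¹ * (A ^ k) i j)) (NormedSpace.exp A i j) := by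
  have h := NormedSpace.exp_series_hasSum_exp' (𝕂 := ℝ) A
  have h2 := (Pi.hasSum.1 ((Pi.hasSum.1 h) i)) j
  exact h2

theorem matrix_pow_nonneg {M : Matrix ι ι ℝ} (hM : ∀ i j, 0 ≤ M i j) (k : ℕ) (i j : ι) :
    0 ≤ (M ^ k) i j := by
  induction k generalizing j with
  | zero => by_cases h : i = j <;> simp [h]
  | succ k ih =>
    rw [pow_succ, Matrix.mul_apply]
    exact Finset.sum_nonneg fun l _ => mul_nonneg (ih l) (hM l j)

theorem matrix_exp_nonneg {M : Matrix ι ι ℝ} (hM : ∀ i j, 0 ≤ M i j) (i j : ι) :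
    0 ≤ NormedSpace.exp M i j :=
  (hasSum_matrix_exp_apply M i j).nonneg fun k =>
    mul_nonneg (by positivity) (matrix_pow_nonneg hM k i j)

theorem matrix_exp_pos {M : Matrix ι ι ℝ} (hM : ∀ i j, 0 ≤ M i j) {i j : ι} {k : ℕ}
    (hk : 0 < (M ^ k) i j) : 0 < NormedSpace.exp M i j :=
  (mul_pos (by positivity) hk).trans_le <|
    le_hasSum (hasSum_matrix_exp_apply M i j) k fun l _ =>
      mul_nonneg (by positivity) (matrix_pow_nonneg hM l i j)

/-- Adding a scalar matrix multiplies the exponential by a positive number. -/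
theorem matrix_exp_eq_of_add_scalar (A : Matrix ι ι ℝ) (c : ℝ) :
    NormedSpace.exp A = Real.exp (-c) • NormedSpace.exp (A + c • 1) := by
  have h : A = (A + c • 1) + (-c) • 1 := by simp [add_assoc]
  have h2 : NormedSpace.exp ((-c) • (1 : Matrix ι ι ℝ)) = Real.exp (-c) • 1 := by
    have := Matrix.exp_diagonal (fun _ : ι => -c)
    rw [Matrix.smul_one_eq_diagonal, this, Matrix.smul_one_eq_diagonal]
    congr 1
    ext i
    rw [Real.exp_eq_exp_ℝ, Pi.coe_exp]
  conv_lhs => rw [h]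
  rw [Matrix.exp_add_of_commute _ _ ((Commute.one_right _).smul_right _), h2]
  simp

theorem matrix_exp_apply_eq_zero {A : Matrix ι ι ℝ} {S : Set ι}
    (hA : ∀ i ∈ S, ∀ j ∉ S, A i j = 0) {i j : ι} (hi : i ∈ S) (hj : j ∉ S) :
    NormedSpace.exp A i j = 0 := by
  have key (k : ℕ) : ∀ j ∉ S, (A ^ k) i j = 0 := by
    induction k with
    | zero =>
      intro j hj
      simp [show i ≠ j by rintro rfl; exact hj hi]
    | succ k ih =>
      intro j hj
      rw [pow_succ, Matrix.mul_apply]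
      refine Finset.sum_eq_zero fun l _ => ?_
      by_cases hl : l ∈ S
      · rw [hA l hl j hj, mul_zero]
      · rw [ih l hl, zero_mul]
  refine (hasSum_matrix_exp_apply A i j).unique ?_
  simp only [key _ j hj, mul_zero]
  exact hasSum_zero

theorem matrix_exp_row_sum {A : Matrix ι ι ℝ} (hA : ∀ i, ∑ j, A i j = 0) (i : ι) :
    ∑ j, NormedSpace.exp A i j = 1 := by
  have key (k : ℕ) : ∑ j, (A ^ (k + 1)) i j = 0 := by
    simp only [pow_succ, Matrix.mul_apply]
    rw [Finset.sum_comm]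
    simp [← Finset.mul_sum, hA]
  have h := hasSum_sum fun j (_ : j ∈ Finset.univ) => hasSum_matrix_exp_apply A i j
  refine h.unique ?_
  convert hasSum_ite_eq (0 : ℕ) (1 : ℝ) using 2 with k
  rcases k with _ | k
  · simp [Matrix.one_apply]
  · rw [← Finset.mul_sum, key]
    simp

/-- Adding a large multiple of the identity makes all entries of the matrix nonnegative. -/
theorem add_scalar_nonneg {A : Matrix ι ι ℝ} (hA0 : ∀ i j, i ≠ j → 0 ≤ A i j) (i j : ι) :
    0 ≤ (A + (∑ k, |A k k|) • (1 : Matrix ι ι ℝ)) i j := by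
  rcases eq_or_ne i j with rfl | h
  · have h1 := Finset.single_le_sum (f := fun k => |A k k|) (fun k _ => abs_nonneg _)
      (Finset.mem_univ i)
    have h2 := neg_abs_le (A i i)
    simp only [Matrix.add_apply, Matrix.smul_apply, Matrix.one_apply_eq, smul_eq_mul, mul_one]
    linarith
  · simpa [h] using hA0 i j h

theorem matrix_exp_mem_rowStochastic {A : Matrix ι ι ℝ} (hA : ∀ i, ∑ j, A i j = 0)
    (hA0 : ∀ i j, i ≠ j → 0 ≤ A i j) : NormedSpace.exp A ∈ Matrix.rowStochastic ℝ ι := by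
  rw [Matrix.mem_rowStochastic_iff_sum]
  refine ⟨fun i j => ?_, matrix_exp_row_sum hA⟩
  rw [matrix_exp_eq_of_add_scalar A (∑ k, |A k k|)]
  exact mul_nonneg (Real.exp_nonneg _) (matrix_exp_nonneg (add_scalar_nonneg hA0) i j)

/-- A path from `r` to `i` along positive off-diagonal entries makes the entry `(i, r)` of the
exponential positive. -/
theorem matrix_exp_apply_pos {A : Matrix ι ι ℝ} (hA0 : ∀ i j, i ≠ j → 0 ≤ A i j) {r i : ι}
    (h : Relation.ReflTransGen (fun u v => u ≠ v ∧ 0 < A v u) r i) :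
    0 < NormedSpace.exp A i r := by
  set c := ∑ k, |A k k|
  have hM : ∀ i j, 0 ≤ (A + c • (1 : Matrix ι ι ℝ)) i j := add_scalar_nonneg hA0
  rw [matrix_exp_eq_of_add_scalar A c]
  have : ∃ k : ℕ, 0 < ((A + c • (1 : Matrix ι ι ℝ)) ^ k) i r := by
    induction h with
    | refl => exact ⟨0, by simp⟩
    | @tail u v _ huv ih =>
      obtain ⟨k, hk⟩ := ih
      refine ⟨k + 1, ?_⟩
      rw [pow_succ', Matrix.mul_apply]
      refine Finset.sum_pos' (fun l _ => mul_nonneg (hM _ _) (matrix_pow_nonneg hM k l r))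
        ⟨u, Finset.mem_univ u, mul_pos ?_ hk⟩
      simpa [huv.1.symm] using huv.2
  obtain ⟨k, hk⟩ := this
  exact mul_pos (Real.exp_pos _) (matrix_exp_pos hM hk)

theorem matrix_exp_add_smul (A : Matrix ι ι ℝ) (s t : ℝ) :
    NormedSpace.exp ((s + t) • A) = NormedSpace.exp (s • A) * NormedSpace.exp (t • A) := by
  rw [add_smul]
  exact Matrix.exp_add_of_commute _ _ (((Commute.refl A).smul_left s).smul_right t)

variable {F : Type*} [NormedAddCommGroup F] [NormedSpace ℝ F]

/-- The solution of `ẏ = A y` starting from `y`. -/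
noncomputable def flow (A : Matrix ι ι ℝ) (t : ℝ) (y : ι → F) : ι → F :=
  act (NormedSpace.exp (t • A)) y

theorem flow_zero (A : Matrix ι ι ℝ) (y : ι → F) : flow A 0 y = y := by
  rw [flow, zero_smul, NormedSpace.exp_zero, act_one]

theorem flow_add (A : Matrix ι ι ℝ) (s t : ℝ) (y : ι → F) :
    flow A (s + t) y = flow A s (flow A t y) := by
  rw [flow, matrix_exp_add_smul, act_mul, flow, flow]

theorem hasDerivAt_flow (A : Matrix ι ι ℝ) (y : ι → F) (t : ℝ) (i : ι) :
    HasDerivAt (fun s => flow A s y i) (act A (flow A t y) i) t := by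
  rw [flow, ← act_mul]
  refine HasDerivAt.fun_sum fun j _ => HasDerivAt.smul_const ?_ _
  have h := hasDerivAt_exp_smul_const' (𝕂 := ℝ) A t
  exact hasDerivAt_pi.1 (hasDerivAt_pi.1 h i) j

/-- Uniqueness of solutions of `ẏ = A y` on `[0, ∞)`. -/
theorem eq_flow_of_hasDerivWithinAt {A : Matrix ι ι ℝ} {y : ℝ → ι → F}
    (hy : ∀ t, 0 ≤ t → ∀ i, HasDerivWithinAt (fun s => y s i) (act A (y t) i) (Set.Ici 0) t)
    {t : ℝ} (ht : 0 ≤ t) : y t = flow A t (y 0) := by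
  let V : (ι → F) →L[ℝ] (ι → F) :=
    ContinuousLinearMap.pi fun i => ∑ j, A i j • ContinuousLinearMap.proj j
  have hV (z : ι → F) : V z = act A z := by
    ext i
    simp [V, act]
  have hd (s : ℝ) (hs : 0 ≤ s) : HasDerivWithinAt y (V (y s)) (Set.Ici 0) s := by
    rw [hV]
    exact hasDerivWithinAt_pi.2 (hy s hs)
  have hf (s : ℝ) : HasDerivAt (fun s => flow A s (y 0)) (V (flow A s (y 0))) s := by
    rw [hV]
    exact hasDerivAt_pi.2 fun i => hasDerivAt_flow A (y 0) s i
  refine ODE_solution_unique_of_mem_Icc_right (v := fun _ => V) (K := ‖V‖₊)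
    (s := fun _ => Set.univ) (a := 0) (b := t)
    (fun _ _ => V.lipschitz.lipschitzOnWith) (fun s hs => ?_) (fun s hs => ?_)
    (fun _ _ => Set.mem_univ _) (fun s _ => (hf s).continuousAt.continuousWithinAt)
    (fun s _ => (hf s).hasDerivWithinAt) (fun _ _ => Set.mem_univ _) (flow_zero A _).symm
    (Set.right_mem_Icc.2 ht)
  · exact (hd s hs.1).continuousWithinAt.mono Set.Icc_subset_Ici_self
  · exact (hd s hs.1).mono (Set.Ici_subset_Ici.2 hs.1)

theorem exp_smul_mem_rowStochastic {A : Matrix ι ι ℝ} (hA : ∀ i, ∑ j, A i j = 0)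
    (hA0 : ∀ i j, i ≠ j → 0 ≤ A i j) {t : ℝ} (ht : 0 ≤ t) :
    NormedSpace.exp (t • A) ∈ Matrix.rowStochastic ℝ ι := by
  refine matrix_exp_mem_rowStochastic (fun i => ?_) fun i j h => mul_nonneg ht (hA0 i j h)
  simp [← Finset.mul_sum, hA]

/-- A set without incoming influences evolves on its own: a common value on it persists. -/
theorem flow_eq_const {A : Matrix ι ι ℝ} (hA : ∀ i, ∑ j, A i j = 0) {S : Set ι}
    (hS : ∀ i ∈ S, ∀ j ∉ S, A i j = 0) {y : ι → F} {c : F} (hy : ∀ j ∈ S, y j = c) (t : ℝ)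
    {i : ι} (hi : i ∈ S) : flow A t y i = c := by
  have h1 : ∑ j, NormedSpace.exp (t • A) i j = 1 :=
    matrix_exp_row_sum (fun i => by simp [← Finset.mul_sum, hA]) i
  have h2 : flow A t y i = ∑ j, NormedSpace.exp (t • A) i j • c := by
    refine Finset.sum_congr rfl fun j _ => ?_
    by_cases hj : j ∈ S
    · rw [hy j hj]
    · rw [matrix_exp_apply_eq_zero (S := S) (fun i hi j hj => by simp [hS i hi j hj]) hi hj,
        zero_smul, zero_smul]
  rw [h2, ← Finset.sum_smul, h1, one_smul]

/-- Consensus: if some vertex influences all vertices, then all components of the solutions of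
`ẏ = A y` tend to a common limit. -/
theorem exists_tendsto_flow [CompleteSpace F] {A : Matrix ι ι ℝ} (hA : ∀ i, ∑ j, A i j = 0)
    (hA0 : ∀ i j, i ≠ j → 0 ≤ A i j) {r : ι}
    (hr : ∀ i, Relation.ReflTransGen (fun u v => u ≠ v ∧ 0 < A v u) r i) (y : ι → F) :
    ∃ c : F, ∀ i, Tendsto (fun t => flow A t y i) atTop (𝓝 c) := by
  have : Nonempty ι := ⟨r⟩
  have hst {t : ℝ} (ht : 0 ≤ t) := exp_smul_mem_rowStochastic hA hA0 ht
  -- At time `1` all rows put weight at least `1 - s` on column `r`. The bound `1 / 2 ≤ s` only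
  -- ensures `0 < s`.
  obtain ⟨s, hs0, hs1, hs⟩ : ∃ s : ℝ, 0 < s ∧ s < 1 ∧
      ∀ i, 1 - s ≤ NormedSpace.exp ((1 : ℝ) • A) i r := by
    obtain ⟨i₀, hi₀⟩ := Finite.exists_min fun i => NormedSpace.exp ((1 : ℝ) • A) i r
    have hpos : 0 < NormedSpace.exp ((1 : ℝ) • A) i₀ r := by
      rw [one_smul]
      exact matrix_exp_apply_pos hA0 (hr i₀)
    refine ⟨max (1 / 2) (1 - NormedSpace.exp ((1 : ℝ) • A) i₀ r), by positivity,
      max_lt (by norm_num) (by linarith), fun i => ?_⟩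
    linarith [hi₀ i, le_max_right (1 / 2) (1 - NormedSpace.exp ((1 : ℝ) • A) i₀ r)]
  obtain ⟨D, hD⟩ : ∃ D : ℝ, ∀ i j, ‖y i - y j‖ ≤ D := by
    obtain ⟨p, hp⟩ := Finite.exists_max fun p : ι × ι => ‖y p.1 - y p.2‖
    exact ⟨_, fun i j => hp (i, j)⟩
  have hgeom (k : ℕ) : ∀ i j, ‖flow A k y i - flow A k y j‖ ≤ D * s ^ k := by
    induction k with
    | zero => simpa [flow_zero] using hD
    | succ k ih =>
      intro i j
      have : flow A ((k + 1 : ℕ) : ℝ) y = flow A 1 (flow A k y) := by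
        rw [← flow_add]
        congr 1
        push_cast
        ring
      rw [this]
      exact (norm_act_sub_act_le (hst zero_le_one) hs0 hs ih i j).trans_eq (by ring)
  have hlate (k : ℕ) {t : ℝ} (ht : (k : ℝ) ≤ t) (i j : ι) :
      ‖flow A t y i - flow A k y j‖ ≤ D * s ^ k := by
    have : flow A t y = flow A (t - k) (flow A k y) := by rw [← flow_add, sub_add_cancel]
    rw [this]
    exact norm_act_sub_le (hst (sub_nonneg.2 ht)) (fun l => hgeom k l j) i
  obtain ⟨c, hc⟩ := cauchySeq_tendsto_of_complete
    (cauchySeq_of_le_geometric (f := fun k : ℕ => flow A k y r) s D hs1 fun k => by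
      rw [dist_comm, dist_eq_norm]
      exact hlate k (by push_cast; linarith) r r)
  refine ⟨c, fun i => ?_⟩
  have hfl : Tendsto (fun t : ℝ => ⌊t⌋₊) atTop atTop := tendsto_nat_floor_atTop
  have hz : Tendsto (fun t : ℝ => flow A t y i - flow A ⌊t⌋₊ y r) atTop (𝓝 0) := by
    refine squeeze_zero_norm' (a := fun t : ℝ => D * s ^ ⌊t⌋₊) ?_ ?_
    · filter_upwards [eventually_ge_atTop 0] with t ht
      exact hlate _ (Nat.floor_le ht) i r
    · simpa using ((tendsto_pow_atTop_nhds_zero_of_lt_one hs0.le hs1).comp hfl).const_mul D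
  simpa using hz.add (hc.comp hfl)

end MatrixExp

/-! ### Exponential and logarithm of quaternions -/

theorem norm_exp_of_re_eq_zero {y : ℍ[ℝ]} (hy : y.re = 0) : ‖NormedSpace.exp y‖ = 1 := by
  rw [Quaternion.norm_exp, hy, NormedSpace.exp_zero, norm_one]

theorem exp_mul_star_exp {y : ℍ[ℝ]} (hy : y.re = 0) :
    NormedSpace.exp y * star (NormedSpace.exp y) = 1 := by
  rw [Quaternion.self_mul_star, Quaternion.normSq_eq_norm_mul_self, norm_exp_of_re_eq_zero hy]
  simp

theorem re_exp_of_re_eq_zero {y : ℍ[ℝ]} (hy : y.re = 0) :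
    (NormedSpace.exp y).re = Real.cos ‖y‖ := by
  rw [Quaternion.exp_of_re_eq_zero y hy]
  simp [hy]

theorem exp_ne_neg_one {y : ℍ[ℝ]} (hy : y.re = 0) (hpi : ‖y‖ < Real.pi) :
    NormedSpace.exp y ≠ -1 := by
  intro h
  have h1 : Real.cos ‖y‖ = Real.cos Real.pi := by
    rw [← re_exp_of_re_eq_zero hy, h, Real.cos_pi]
    simp
  exact hpi.ne (Real.injOn_cos ⟨norm_nonneg _, hpi.le⟩ ⟨Real.pi_pos.le, le_rfl⟩ h1)

theorem qlog_re (r : ℍ[ℝ]) : (qlog r).re = 0 := by simp [qlog]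

theorem qlog_exp {y : ℍ[ℝ]} (hy : y.re = 0) (hpi : ‖y‖ < Real.pi) :
    qlog (NormedSpace.exp y) = y := by
  rcases eq_or_ne y 0 with rfl | h0
  · simp [qlog]
  have h := norm_ne_zero_iff.2 h0
  have := qlog_cos_add_sin (φ := 2 * ‖y‖) (by positivity) (by linarith) (n := ‖y‖⁻¹ • y)
    (by simp [hy]) (by rw [norm_smul, norm_inv, norm_norm, inv_mul_cancel₀ h])
  rw [mul_div_cancel_left₀ _ two_ne_zero, smul_smul, smul_smul, ← div_eq_mul_inv,
    ← Quaternion.exp_of_re_eq_zero y hy, mul_inv_cancel₀ h, one_smul] at this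
  exact this

theorem re_sq_add_norm_im_sq (r : ℍ[ℝ]) : r.re ^ 2 + ‖r.im‖ ^ 2 = ‖r‖ ^ 2 := by
  simp only [sq, ← Quaternion.normSq_eq_norm_mul_self, Quaternion.normSq_def']
  simp
  ring

theorem norm_im_eq_sin_arccos {r : ℍ[ℝ]} (hr : ‖r‖ = 1) :
    ‖r.im‖ = Real.sin (Real.arccos r.re) := by
  rw [Real.sin_arccos, ← Real.sqrt_sq (norm_nonneg r.im)]
  congr 1
  have := re_sq_add_norm_im_sq r
  rw [hr] at this
  linarith

theorem abs_re_le_one {r : ℍ[ℝ]} (hr : ‖r‖ = 1) : |r.re| ≤ 1 := by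
  rw [← sq_le_one_iff_abs_le_one]
  have := re_sq_add_norm_im_sq r
  rw [hr] at this
  nlinarith [sq_nonneg ‖r.im‖]

/-- For a unit quaternion, a vanishing imaginary part means `±1`. -/
theorem eq_one_or_eq_neg_one_of_im_eq_zero {r : ℍ[ℝ]} (hr : ‖r‖ = 1) (h : r.im = 0) :
    r = 1 ∨ r = -1 := by
  have h1 := re_sq_add_norm_im_sq r
  rw [hr, h, norm_zero] at h1
  have h2 : r = (r.re : ℍ[ℝ]) := by
    conv_lhs => rw [← Quaternion.re_add_im r, h, add_zero]
  rcases mul_self_eq_one_iff.1 (show r.re * r.re = 1 by linarith) with h3 | h3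
  · left; rw [h2, h3]; simp
  · right; rw [h2, h3]; simp

theorem arccos_re_lt_pi {r : ℍ[ℝ]} (hr : ‖r‖ = 1) (hr1 : r ≠ -1) : Real.arccos r.re < Real.pi := by
  refine (Real.arccos_le_pi _).lt_of_ne fun h => ?_
  have h1 : r.re = -1 := le_antisymm (Real.arccos_eq_pi.1 h) (abs_le.1 (abs_re_le_one hr)).1
  have h2 := re_sq_add_norm_im_sq r
  rw [hr, h1] at h2
  have h3 : r.im = 0 := norm_eq_zero.1 (pow_eq_zero_iff two_ne_zero |>.1 (by linarith))
  rcases eq_one_or_eq_neg_one_of_im_eq_zero hr h3 with rfl | rfl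
  · norm_num at h1
  · exact hr1 rfl

theorem norm_qlog_lt {r : ℍ[ℝ]} (hr : ‖r‖ = 1) (hr1 : r ≠ -1) : ‖qlog r‖ < Real.pi := by
  rcases eq_or_ne r.im 0 with h | h
  · simpa [qlog, h] using Real.pi_pos
  · rw [qlog, norm_smul, norm_smul, norm_inv, norm_norm, inv_mul_cancel₀ (norm_ne_zero_iff.2 h),
      mul_one, Real.norm_of_nonneg (Real.arccos_nonneg _)]
    exact arccos_re_lt_pi hr hr1

theorem exp_qlog {r : ℍ[ℝ]} (hr : ‖r‖ = 1) (hr1 : r ≠ -1) : NormedSpace.exp (qlog r) = r := by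
  rcases eq_or_ne r.im 0 with h | h
  · rcases eq_one_or_eq_neg_one_of_im_eq_zero hr h with rfl | rfl
    · simp [qlog]
    · exact absurd rfl hr1
  have hn : ‖qlog r‖ = Real.arccos r.re := by
    rw [qlog, norm_smul, norm_smul, norm_inv, norm_norm, inv_mul_cancel₀ (norm_ne_zero_iff.2 h),
      mul_one, Real.norm_of_nonneg (Real.arccos_nonneg _)]
  have h0 : Real.arccos r.re ≠ 0 := by
    intro h0
    have := norm_im_eq_sin_arccos hr
    rw [h0, Real.sin_zero] at this
    exact h (norm_eq_zero.1 this)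
  obtain ⟨h1, h2⟩ := abs_le.1 (abs_re_le_one hr)
  rw [Quaternion.exp_of_re_eq_zero _ (qlog_re r), hn, Real.cos_arccos h1 h2, qlog, smul_smul,
    smul_smul, ← norm_im_eq_sin_arccos hr, div_mul_cancel₀ _ h0,
    mul_inv_cancel₀ (norm_ne_zero_iff.2 h), one_smul, Quaternion.re_add_im]

/-! ### Differentiating exponential and logarithm -/

theorem pure3_vec3_of_re_eq_zero {h : ℍ[ℝ]} (hh : h.re = 0) : pure3 (vec3 h) = h := by
  ext <;> simp [pure3, vec3, hh]

theorem re_pure3 (v : Fin 3 → ℝ) : (pure3 v).re = 0 := rfl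

theorem imI_pure3 (v : Fin 3 → ℝ) : (pure3 v).imI = v 0 := rfl

theorem imJ_pure3 (v : Fin 3 → ℝ) : (pure3 v).imJ = v 1 := rfl

theorem imK_pure3 (v : Fin 3 → ℝ) : (pure3 v).imK = v 2 := rfl

/-- The embedding of `ℝ³` as the pure quaternions, as a continuous linear map. -/
noncomputable def pure3L : (Fin 3 → ℝ) →L[ℝ] ℍ[ℝ] :=
  LinearMap.toContinuousLinearMap
    { toFun := pure3
      map_add' := fun v w => by
        ext <;> simp [re_pure3, imI_pure3, imJ_pure3, imK_pure3]
      map_smul' := fun c v => by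
        ext <;> simp [re_pure3, imI_pure3, imJ_pure3, imK_pure3] }

theorem pure3L_apply (v : Fin 3 → ℝ) : pure3L v = pure3 v := rfl

/-- The imaginary part of a quaternion, as a continuous linear map. -/
noncomputable def imL : ℍ[ℝ] →L[ℝ] ℍ[ℝ] :=
  LinearMap.toContinuousLinearMap
    { toFun := fun h => h.im
      map_add' := fun v w => by ext <;> simp
      map_smul' := fun c v => by ext <;> simp }

theorem imL_apply (h : ℍ[ℝ]) : imL h = h.im := rfl

/-- The coefficients of a pure quaternion, as a continuous linear map. -/
noncomputable def vec3L : ℍ[ℝ] →L[ℝ] (Fin 3 → ℝ) :=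
  LinearMap.toContinuousLinearMap
    { toFun := vec3
      map_add' := fun v w => by ext i; fin_cases i <;> simp [vec3]
      map_smul' := fun c v => by ext i; fin_cases i <;> simp [vec3] }

theorem vec3L_apply (h : ℍ[ℝ]) : vec3L h = vec3 h := rfl

/-- The coefficients of a quaternion, as a continuous linear equivalence. -/
noncomputable def vec4L : ℍ[ℝ] ≃L[ℝ] (Fin 4 → ℝ) :=
  LinearEquiv.toContinuousLinearEquiv
    { toFun := vec4
      invFun := fun v => ⟨v 0, v 1, v 2, v 3⟩
      left_inv := fun h => by ext <;> simp [vec4]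
      right_inv := fun v => by ext i; fin_cases i <;> simp [vec4]
      map_add' := fun v w => by ext i; fin_cases i <;> simp [vec4]
      map_smul' := fun c v => by ext i; fin_cases i <;> simp [vec4] }

/-- The exponential map, as a map from `ℝ³`, the space of pure quaternions. -/
noncomputable def expPure (v : Fin 3 → ℝ) : ℍ[ℝ] := NormedSpace.exp (pure3 v)

theorem differentiableAt_expPure (v : Fin 3 → ℝ) : DifferentiableAt ℝ expPure v :=
  (NormedSpace.exp_analytic (𝕂 := ℝ) (pure3 v)).differentiableAt.comp v
    pure3L.differentiableAt

theorem Q_mulVec (r : ℍ[ℝ]) (v : Fin 3 → ℝ) :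
    (Q r).mulVec v = vec4 (fderiv ℝ expPure (vec3 (qlog r)) v) := by
  have h : fderiv ℝ (fun v : Fin 3 → ℝ => vec4 (NormedSpace.exp (pure3 v))) (vec3 (qlog r)) =
      (vec4L : ℍ[ℝ] →L[ℝ] (Fin 4 → ℝ)).comp (fderiv ℝ expPure (vec3 (qlog r))) :=
    ((vec4L : ℍ[ℝ] →L[ℝ] (Fin 4 → ℝ)).hasFDerivAt.comp _
      (differentiableAt_expPure _).hasFDerivAt).fderiv
  rw [Q, h, LinearMap.toMatrix'_mulVec]
  rfl

theorem differentiableAt_qlog {r : ℍ[ℝ]} (h0 : r.im ≠ 0) (h1 : ‖r‖ = 1) :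
    DifferentiableAt ℝ qlog r := by
  have hre : DifferentiableAt ℝ (fun q : ℍ[ℝ] => q.re) r :=
    ((ContinuousLinearMap.proj (R := ℝ) (φ := fun _ : Fin 4 => ℝ) 0).comp
      (vec4L : ℍ[ℝ] →L[ℝ] (Fin 4 → ℝ))).differentiableAt
  have him : DifferentiableAt ℝ (fun q : ℍ[ℝ] => q.im) r := imL.differentiableAt
  have h2 := re_sq_add_norm_im_sq r
  have h3 : 0 < ‖r.im‖ := norm_pos_iff.2 h0
  rw [h1] at h2
  have hac : DifferentiableAt ℝ Real.arccos r.re := by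
    refine Real.differentiableAt_arccos.2 ⟨fun h => ?_, fun h => ?_⟩ <;>
    · rw [h] at h2
      nlinarith
  exact (hac.comp r hre).smul (((him.norm ℝ h0).inv h3.ne').smul him)

/-- On unit quaternions, `log r` is a continuous multiple of the imaginary part of `r`. -/
theorem qlog_eq_sinc_smul_im {r : ℍ[ℝ]} (hr : ‖r‖ = 1) :
    qlog r = (Real.sinc (Real.arccos r.re))⁻¹ • r.im := by
  rcases eq_or_ne r.im 0 with h | h
  · simp [qlog, h]
  have hs := norm_im_eq_sin_arccos hr
  have h0 : Real.arccos r.re ≠ 0 := by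
    intro h0
    rw [h0, Real.sin_zero] at hs
    exact h (norm_eq_zero.1 hs)
  rw [Real.sinc_of_ne_zero h0, ← hs, qlog, smul_smul, inv_div, div_eq_mul_inv]

/-- Along a curve of unit quaternions `r` whose velocity is the image of `u` under the differential
of the exponential map at `log r`, the velocity of `log r` is `u`. Away from `r = 1` this is
the chain rule for `log ∘ exp = id`; near `r = 1`, where the formula for `log` is
singular, `log r` differs from the imaginary part of `r` by a factor that tends to `1`. -/
theorem hasDerivWithinAt_qlog {r : ℝ → ℍ[ℝ]} {S : Set ℝ} {t : ℝ} (ht : t ∈ S) {u : ℍ[ℝ]}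
    (hu : u.re = 0) (hr : ∀ s ∈ S, ‖r s‖ = 1) (hr1 : r t ≠ -1)
    (hd : HasDerivWithinAt r (fderiv ℝ expPure (vec3 (qlog (r t))) (vec3 u)) S t) :
    HasDerivWithinAt (fun s => qlog (r s)) u S t := by
  have hexp : expPure (vec3 (qlog (r t))) = r t := by
    rw [expPure, pure3_vec3_of_re_eq_zero (qlog_re _), exp_qlog (hr t ht) hr1]
  by_cases him : (r t).im = 0
  · have hrt : r t = 1 :=
      (eq_one_or_eq_neg_one_of_im_eq_zero (hr t ht) him).resolve_right hr1
    have hlog : qlog (r t) = 0 := by simp [qlog, him]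
    have hv0 : vec3 (0 : ℍ[ℝ]) = 0 := vec3L.map_zero
    have hder : fderiv ℝ expPure (vec3 (qlog (r t))) (vec3 u) = u := by
      have h0 : HasFDerivAt (NormedSpace.exp : ℍ[ℝ] → ℍ[ℝ]) (1 : ℍ[ℝ] →L[ℝ] ℍ[ℝ]) (pure3L 0) := by
        rw [map_zero]
        exact hasFDerivAt_exp_zero
      have h1 : HasFDerivAt expPure ((1 : ℍ[ℝ] →L[ℝ] ℍ[ℝ]).comp pure3L) 0 :=
        h0.comp 0 pure3L.hasFDerivAt
      rw [hlog, hv0, h1.fderiv]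
      exact pure3_vec3_of_re_eq_zero hu
    rw [hder] at hd
    have hd2 : HasDerivWithinAt (fun s => (r s).im) u S t := by
      have := (imL.hasFDerivAt.comp_hasDerivWithinAt t hd)
      rwa [show imL u = u by rw [imL_apply]; ext <;> simp [hu]] at this
    rw [hasDerivWithinAt_iff_tendsto_slope] at hd2 ⊢
    have hc : Tendsto (fun s => (Real.sinc (Real.arccos (r s).re))⁻¹) (𝓝[S \ {t}] t) (𝓝 1) := by
      have h1 : ContinuousWithinAt (fun s => Real.sinc (Real.arccos (r s).re)) S t :=
        (Real.continuous_sinc.comp (Real.continuous_arccos.comp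
          Quaternion.continuous_re)).continuousAt.comp_continuousWithinAt hd.continuousWithinAt
      have h2 := (h1.mono Set.sdiff_subset).tendsto (s := S \ {t})
      rw [hrt] at h2
      simpa using h2.inv₀ (by simp)
    have := hc.smul hd2
    rw [one_smul] at this
    refine this.congr' ?_
    filter_upwards [self_mem_nhdsWithin] with s hs
    rw [slope_def_module, slope_def_module, hlog, him, sub_zero, sub_zero,
      qlog_eq_sinc_smul_im (hr s hs.1), smul_comm]
  · have hD := (differentiableAt_qlog him (hr t ht)).hasFDerivAt
    rw [← hexp] at hD
    have hcomp := hD.comp _ (differentiableAt_expPure _).hasFDerivAt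
    have hloc : (qlog ∘ expPure) =ᶠ[𝓝 (vec3 (qlog (r t)))] pure3L := by
      have hopen : ∀ᶠ v in 𝓝 (vec3 (qlog (r t))), ‖pure3L v‖ < Real.pi := by
        refine pure3L.continuous.norm.continuousAt.eventually_lt continuousAt_const ?_
        rw [pure3L_apply, pure3_vec3_of_re_eq_zero (qlog_re _)]
        exact norm_qlog_lt (hr t ht) hr1
      filter_upwards [hopen] with v hv
      exact qlog_exp (re_pure3 v) hv
    have heq := hcomp.unique (pure3L.hasFDerivAt.congr_of_eventuallyEq hloc)
    rw [hexp] at hD heq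
    have := hD.comp_hasDerivWithinAt t hd
    have h2 := congrArg (fun L => L (vec3 u)) heq
    simp only [ContinuousLinearMap.comp_apply] at h2
    rw [h2, pure3L_apply, pure3_vec3_of_re_eq_zero hu] at this
    exact this

/-! ### Dual quaternions -/

theorem hamPlus4_mulVec (g h : ℍ[ℝ]) : (hamPlus4 g).mulVec (vec4 h) = vec4 (g * h) := by
  ext i
  fin_cases i <;> simp [hamPlus4, vec4, Matrix.mulVec, dotProduct, Fin.sum_univ_four] <;> ring

theorem hamMinus4_mulVec (g h : ℍ[ℝ]) : (hamMinus4 h).mulVec (vec4 g) = vec4 (g * h) := by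
  ext i
  fin_cases i <;> simp [hamMinus4, vec4, Matrix.mulVec, dotProduct, Fin.sum_univ_four] <;> ring

theorem Qp_mulVec (v : Fin 3 → ℝ) : Qp.mulVec v = vec4 (pure3 v) := by
  ext i
  fin_cases i <;> simp [Qp, vec4, pure3, Matrix.mulVec, dotProduct, Fin.sum_univ_three]

theorem vec4_add (g h : ℍ[ℝ]) : vec4 (g + h) = vec4 g + vec4 h := vec4L.map_add g h

theorem vec4_smul (c : ℝ) (h : ℍ[ℝ]) : vec4 (c • h) = c • vec4 h := vec4L.map_smul c h

theorem hamMinus8_mulVec (g h : DualQuat) : (hamMinus8 h).mulVec (vec8 g) = vec8 (g * h) := by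
  rw [hamMinus8, vec8, Matrix.fromBlocks_mulVec]
  simp [vec8, hamMinus4_mulVec, ← vec4_add]

theorem isUnitDualQuat_iff (x : DualQuat) : IsUnitDualQuat x ↔
    x.fst * star x.fst = 1 ∧ x.fst * star x.snd + x.snd * star x.fst = 0 := by
  rw [IsUnitDualQuat, TrivSqZeroExt.ext_iff]
  simp [conj]

theorem norm_eq_one_of_mul_star {r : ℍ[ℝ]} (h : r * star r = 1) : ‖r‖ = 1 := by
  rw [Quaternion.self_mul_star, Quaternion.normSq_eq_norm_mul_self] at h
  have h1 : ‖r‖ * ‖r‖ = 1 := Quaternion.coe_injective (by rw [h, Quaternion.coe_one])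
  nlinarith [norm_nonneg r]

theorem star_mul_self_of_mul_star {r : ℍ[ℝ]} (h : r * star r = 1) : star r * r = 1 := by
  rwa [Quaternion.star_mul_self, ← Quaternion.self_mul_star]

theorem conj_mul_self {x : DualQuat} (hx : IsUnitDualQuat x) : conj x * x = 1 := by
  obtain ⟨h1, h2⟩ := (isUnitDualQuat_iff x).1 hx
  have h3 := star_mul_self_of_mul_star h1
  have h4 : star x.fst * x.snd + star x.snd * x.fst = 0 := by
    have : star x.fst * (x.fst * star x.snd + x.snd * star x.fst) * x.fst = 0 := by
      rw [h2, mul_zero, zero_mul]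
    rw [mul_add, add_mul, ← mul_assoc, h3, one_mul, mul_assoc, mul_assoc, h3, mul_one] at this
    rw [add_comm]
    exact this
  rw [TrivSqZeroExt.ext_iff]
  constructor <;> simp [conj, h3, h4]

theorem conj_mul (x y : DualQuat) : conj (x * y) = conj y * conj x := by
  rw [TrivSqZeroExt.ext_iff]
  constructor <;> simp [conj]
  abel

theorem IsUnitDualQuat.mul {x y : DualQuat} (hx : IsUnitDualQuat x) (hy : IsUnitDualQuat y) :
    IsUnitDualQuat (x * y) := by
  rw [IsUnitDualQuat, conj_mul, mul_assoc, ← mul_assoc y, hy, one_mul, hx]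

/-- The exponential of a pure dual quaternion `z.1 + ε z.2`, given by its two components;
its rotation part is `exp z.1` and its translation is `2 z.2`. -/
noncomputable def dexp (z : ℍ[ℝ] × ℍ[ℝ]) : DualQuat :=
  TrivSqZeroExt.inl (NormedSpace.exp z.1) + TrivSqZeroExt.inr (z.2 * NormedSpace.exp z.1)

/-- The two components of the logarithm of a dual quaternion, in the normed space `ℍ × ℍ`. -/
noncomputable def logPair (x : DualQuat) : ℍ[ℝ] × ℍ[ℝ] :=
  (qlog x.fst, (1 / 2 : ℝ) • translation x)

theorem dqlog_eq (x : DualQuat) :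
    dqlog x = TrivSqZeroExt.inl (logPair x).1 + TrivSqZeroExt.inr (logPair x).2 := rfl

theorem dexp_fst (z : ℍ[ℝ] × ℍ[ℝ]) : (dexp z).fst = NormedSpace.exp z.1 := by simp [dexp]

theorem dexp_snd (z : ℍ[ℝ] × ℍ[ℝ]) : (dexp z).snd = z.2 * NormedSpace.exp z.1 := by simp [dexp]

theorem star_eq_neg_of_re_eq_zero {h : ℍ[ℝ]} (hh : h.re = 0) : star h = -h :=
  Quaternion.star_eq_neg.2 hh

theorem isUnitDualQuat_dexp {z : ℍ[ℝ] × ℍ[ℝ]} (h1 : z.1.re = 0) (h2 : z.2.re = 0) :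
    IsUnitDualQuat (dexp z) := by
  rw [isUnitDualQuat_iff, dexp_fst, dexp_snd]
  refine ⟨exp_mul_star_exp h1, ?_⟩
  rw [star_mul, ← mul_assoc, exp_mul_star_exp h1, mul_assoc, exp_mul_star_exp h1,
    star_eq_neg_of_re_eq_zero h2]
  simp

theorem translation_dexp {z : ℍ[ℝ] × ℍ[ℝ]} (h1 : z.1.re = 0) :
    translation (dexp z) = (2 : ℝ) • z.2 := by
  rw [translation, dexp_fst, dexp_snd, mul_assoc, exp_mul_star_exp h1, mul_one]

theorem inLogDomain_dexp {z : ℍ[ℝ] × ℍ[ℝ]} (h1 : z.1.re = 0) (h2 : z.2.re = 0)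
    (hpi : ‖z.1‖ < Real.pi) : InLogDomain (dexp z) :=
  ⟨isUnitDualQuat_dexp h1 h2, by rw [dexp_fst]; exact exp_ne_neg_one h1 hpi⟩

theorem logPair_dexp {z : ℍ[ℝ] × ℍ[ℝ]} (h1 : z.1.re = 0) (hpi : ‖z.1‖ < Real.pi) :
    logPair (dexp z) = z := by
  rw [logPair, translation_dexp h1, dexp_fst, qlog_exp h1 hpi, smul_smul]
  norm_num

theorem InLogDomain.norm_fst {x : DualQuat} (hx : InLogDomain x) : ‖x.fst‖ = 1 :=
  norm_eq_one_of_mul_star ((isUnitDualQuat_iff x).1 hx.1).1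

theorem dexp_logPair {x : DualQuat} (hx : InLogDomain x) : dexp (logPair x) = x := by
  obtain ⟨h1, -⟩ := (isUnitDualQuat_iff x).1 hx.1
  have he : NormedSpace.exp (logPair x).1 = x.fst := exp_qlog hx.norm_fst hx.2
  rw [TrivSqZeroExt.ext_iff, dexp_fst, dexp_snd, he]
  refine ⟨rfl, ?_⟩
  rw [logPair, translation, smul_smul, smul_mul_assoc, mul_assoc, star_mul_self_of_mul_star h1]
  norm_num

theorem logPair_fst_re (x : DualQuat) : (logPair x).1.re = 0 := qlog_re _

theorem logPair_snd_re {x : DualQuat} (hx : InLogDomain x) : (logPair x).2.re = 0 := by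
  obtain ⟨-, h2⟩ := (isUnitDualQuat_iff x).1 hx.1
  have h3 : star (x.snd * star x.fst) = x.fst * star x.snd := by rw [star_mul, star_star]
  have h4 : star (x.snd * star x.fst) = -(x.snd * star x.fst) := by
    rw [h3]
    exact eq_neg_of_add_eq_zero_left h2
  have := Quaternion.star_eq_neg.1 h4
  simp only [logPair, translation, Quaternion.re_smul, this, smul_zero]

theorem norm_logPair_fst_lt {x : DualQuat} (hx : InLogDomain x) : ‖(logPair x).1‖ < Real.pi :=
  norm_qlog_lt hx.norm_fst hx.2

theorem continuous_dexp : Continuous dexp := by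
  have h : Continuous fun z : ℍ[ℝ] × ℍ[ℝ] => NormedSpace.exp z.1 := by
    have : Continuous (NormedSpace.exp : ℍ[ℝ] → ℍ[ℝ]) :=
      continuous_iff_continuousAt.2 fun y =>
        (NormedSpace.exp_analytic (𝕂 := ℝ) y).continuousAt
    exact this.comp continuous_fst
  exact (TrivSqZeroExt.continuous_inl.comp h).add
    (TrivSqZeroExt.continuous_inr.comp (continuous_snd.mul h))

/-! ### Kinematics in logarithmic coordinates -/

/-- The velocity of the pose `x` when its logarithm has velocity `u.1 + ε u.2`. -/
noncomputable def dexpVel (x : DualQuat) (u : ℍ[ℝ] × ℍ[ℝ]) : DualQuat :=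
  TrivSqZeroExt.inl (fderiv ℝ expPure (vec3 (qlog x.fst)) (vec3 u.1)) +
    TrivSqZeroExt.inr ((logPair x).2 * fderiv ℝ expPure (vec3 (qlog x.fst)) (vec3 u.1) +
      pure3 (vec3 u.2) * x.fst)

theorem Q8_mulVec (x : DualQuat) (u : ℍ[ℝ] × ℍ[ℝ]) :
    (Q8 x).mulVec (Sum.elim (vec3 u.1) (vec3 u.2)) = vec8 (dexpVel x u) := by
  rw [Q8, Matrix.fromBlocks_mulVec]
  simp only [Sum.elim_comp_inl, Sum.elim_comp_inr, Matrix.zero_mulVec, add_zero,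
    Matrix.smul_mulVec, ← Matrix.mulVec_mulVec, Q_mulVec, Qp_mulVec, hamPlus4_mulVec,
    hamMinus4_mulVec, ← vec4_smul, ← vec4_add]
  simp [vec8, dexpVel, logPair]

theorem hasDerivWithinAt_vec8_iff {x : ℝ → DualQuat} {v : DualQuat} {S : Set ℝ} {t : ℝ} :
    HasDerivWithinAt (fun s => vec8 (x s)) (vec8 v) S t ↔
      HasDerivWithinAt (fun s => (x s).fst) v.fst S t ∧
        HasDerivWithinAt (fun s => (x s).snd) v.snd S t := by
  have key (f : ℝ → ℍ[ℝ]) (w : ℍ[ℝ]) : HasDerivWithinAt f w S t ↔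
      ∀ k, HasDerivWithinAt (fun s => vec4 (f s) k) (vec4 w k) S t := by
    rw [← hasDerivWithinAt_pi]
    constructor
    · exact fun h => (vec4L : ℍ[ℝ] →L[ℝ] (Fin 4 → ℝ)).hasFDerivAt.comp_hasDerivWithinAt t h
    · intro h
      have := (vec4L.symm : (Fin 4 → ℝ) →L[ℝ] ℍ[ℝ]).hasFDerivAt.comp_hasDerivWithinAt t h
      convert! this using 1
  rw [hasDerivWithinAt_pi, Sum.forall, key, key]
  rfl

theorem hasDerivWithinAt_vec8_mul_const {x : ℝ → DualQuat} {v : DualQuat} {S : Set ℝ} {t : ℝ}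
    (h : HasDerivWithinAt (fun s => vec8 (x s)) (vec8 v) S t) (d : DualQuat) :
    HasDerivWithinAt (fun s => vec8 (x s * d)) (vec8 (v * d)) S t := by
  simp only [← hamMinus8_mulVec]
  exact (Matrix.mulVecLin (hamMinus8 d)).toContinuousLinearMap.hasFDerivAt.comp_hasDerivWithinAt t h

theorem hasDerivWithinAt_exp {y : ℝ → ℍ[ℝ]} {u : ℍ[ℝ]} {S : Set ℝ} {t : ℝ}
    (hy : ∀ s, (y s).re = 0) (h : HasDerivWithinAt y u S t) :
    HasDerivWithinAt (fun s => NormedSpace.exp (y s)) (fderiv ℝ expPure (vec3 (y t)) (vec3 u))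
      S t := by
  have h1 : HasDerivWithinAt (fun s => vec3 (y s)) (vec3 u) S t :=
    vec3L.hasFDerivAt.comp_hasDerivWithinAt t h
  have h2 := (differentiableAt_expPure (vec3 (y t))).hasFDerivAt.comp_hasDerivWithinAt t h1
  convert! h2 using 1
  ext1 s
  rw [Function.comp_apply, expPure, pure3_vec3_of_re_eq_zero (hy s)]

/-- Conjugation, as a continuous linear map. -/
noncomputable def starL : ℍ[ℝ] →L[ℝ] ℍ[ℝ] :=
  LinearMap.toContinuousLinearMap
    { toFun := star
      map_add' := star_add
      map_smul' := fun c v => by ext <;> simp }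

theorem hasDerivWithinAt_star {r : ℝ → ℍ[ℝ]} {ρ : ℍ[ℝ]} {S : Set ℝ} {t : ℝ}
    (h : HasDerivWithinAt r ρ S t) : HasDerivWithinAt (fun s => star (r s)) (star ρ) S t :=
  starL.hasFDerivAt.comp_hasDerivWithinAt t h

/-- The image of the differential of `exp` is tangent to the sphere of unit quaternions. -/
theorem mul_star_fderiv_expPure {y u : ℍ[ℝ]} (hy : y.re = 0) (hu : u.re = 0) :
    NormedSpace.exp y * star (fderiv ℝ expPure (vec3 y) (vec3 u)) +
      fderiv ℝ expPure (vec3 y) (vec3 u) * star (NormedSpace.exp y) = 0 := by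
  have hre (s : ℝ) : (y + s • u).re = 0 := by simp [hy, hu]
  have hline : HasDerivWithinAt (fun s : ℝ => y + s • u) u Set.univ 0 := by
    simpa using (((hasDerivAt_id (0 : ℝ)).smul_const u).const_add y).hasDerivWithinAt
      (s := Set.univ)
  have h1 := hasDerivWithinAt_exp hre hline
  have h2 := (h1.mul (hasDerivWithinAt_star h1)).hasDerivAt Filter.univ_mem
  simp only [zero_smul, add_zero] at h2
  have h3 : HasDerivAt (fun _ : ℝ => (1 : ℍ[ℝ])) 0 0 := hasDerivAt_const _ _
  rw [add_comm]
  refine h2.unique (h3.congr_of_eventuallyEq (Eventually.of_forall fun s => ?_))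
  exact exp_mul_star_exp (hre s)

theorem hasDerivWithinAt_dexp {z : ℝ → ℍ[ℝ] × ℍ[ℝ]} {u : ℍ[ℝ] × ℍ[ℝ]} {S : Set ℝ} {t : ℝ}
    (hz1 : ∀ s, (z s).1.re = 0) (hpi : ‖(z t).1‖ < Real.pi) (hu : u.2.re = 0)
    (h : HasDerivWithinAt z u S t) :
    HasDerivWithinAt (fun s => vec8 (dexp (z s))) (vec8 (dexpVel (dexp (z t)) u)) S t := by
  have hz1' : HasDerivWithinAt (fun s => (z s).1) u.1 S t :=
    (ContinuousLinearMap.fst ℝ ℍ[ℝ] ℍ[ℝ]).hasFDerivAt.comp_hasDerivWithinAt t h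
  have hz2' : HasDerivWithinAt (fun s => (z s).2) u.2 S t :=
    (ContinuousLinearMap.snd ℝ ℍ[ℝ] ℍ[ℝ]).hasFDerivAt.comp_hasDerivWithinAt t h
  have he := hasDerivWithinAt_exp hz1 hz1'
  have hq : qlog (NormedSpace.exp (z t).1) = (z t).1 := qlog_exp (hz1 t) hpi
  rw [hasDerivWithinAt_vec8_iff]
  simp only [dexpVel, dexp_fst, dexp_snd, TrivSqZeroExt.fst_add, TrivSqZeroExt.snd_add,
    TrivSqZeroExt.fst_inl, TrivSqZeroExt.snd_inl, TrivSqZeroExt.fst_inr, TrivSqZeroExt.snd_inr,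
    add_zero, zero_add, hq, logPair_dexp (hz1 t) hpi, pure3_vec3_of_re_eq_zero hu]
  refine ⟨he, ?_⟩
  rw [add_comm]
  exact hz2'.mul he

/-- The kinematic equation, solved for the velocity of the logarithm. -/
theorem hasDerivWithinAt_logPair {x : ℝ → DualQuat} {u : ℍ[ℝ] × ℍ[ℝ]} {S : Set ℝ} {t : ℝ}
    (ht : t ∈ S) (hx : ∀ s ∈ S, InLogDomain (x s)) (hu1 : u.1.re = 0) (hu2 : u.2.re = 0)
    (h : HasDerivWithinAt (fun s => vec8 (x s)) (vec8 (dexpVel (x t) u)) S t) :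
    HasDerivWithinAt (fun s => logPair (x s)) u S t := by
  obtain ⟨h1, h2⟩ := hasDerivWithinAt_vec8_iff.1 h
  set ρ := fderiv ℝ expPure (vec3 (qlog (x t).fst)) (vec3 u.1) with hρ
  have e1 : (dexpVel (x t) u).fst = ρ := by simp [dexpVel, hρ]
  have e2 : (dexpVel (x t) u).snd = (logPair (x t)).2 * ρ + u.2 * (x t).fst := by
    simp [dexpVel, hρ, pure3_vec3_of_re_eq_zero hu2]
  rw [e1] at h1
  rw [e2] at h2
  have hunit := ((isUnitDualQuat_iff (x t)).1 (hx t ht).1).1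
  have hlog := hasDerivWithinAt_qlog ht hu1 (fun s hs => (hx s hs).norm_fst) (hx t ht).2 h1
  have hcancel : (x t).fst * star ρ + ρ * star (x t).fst = 0 := by
    have := mul_star_fderiv_expPure (qlog_re (x t).fst) hu1
    rwa [exp_qlog (hx t ht).norm_fst (hx t ht).2] at this
  have hy2 : HasDerivWithinAt (fun s => (x s).snd * star (x s).fst) u.2 S t := by
    have := h2.mul (hasDerivWithinAt_star h1)
    convert! this using 1
    have h3 : (x t).snd = (logPair (x t)).2 * (x t).fst := by
      conv_lhs => rw [← dexp_logPair (hx t ht), dexp_snd, ← dexp_fst, dexp_logPair (hx t ht)]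
    rw [h3, add_mul, mul_assoc, mul_assoc, hunit, mul_one, mul_assoc, add_right_comm, ← mul_add,
      add_comm (ρ * _), hcancel, mul_zero, zero_add]
  have heq : (fun s => logPair (x s)) =
      fun s => (qlog (x s).fst, (x s).snd * star (x s).fst) := by
    ext1 s
    rw [logPair, translation, smul_smul]
    norm_num
  rw [heq]
  exact hlog.prodMk hy2

/-! ### The closed loop in logarithmic coordinates -/

variable {n : ℕ}

/-- The negative of the graph Laplacian. -/
def negLaplacian (G : WeightedDigraph n) : Matrix (Fin n) (Fin n) ℝ :=
  G.weight - Matrix.diagonal fun i => ∑ j, G.weight i j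

theorem negLaplacian_row_sum (G : WeightedDigraph n) (i : Fin n) :
    ∑ j, negLaplacian G i j = 0 := by
  simp [negLaplacian, Finset.sum_sub_distrib, Matrix.diagonal_apply]

theorem negLaplacian_of_ne (G : WeightedDigraph n) {i j : Fin n} (h : i ≠ j) :
    negLaplacian G i j = G.weight i j := by
  simp [negLaplacian, h]

theorem WeightedDigraph.weight_nonneg (G : WeightedDigraph n) (i j : Fin n) :
    0 ≤ G.weight i j := by
  by_cases h : G.Adj j i
  · exact (G.weight_pos i j h).le
  · exact (G.weight_eq_zero i j h).ge

theorem negLaplacian_nonneg_of_ne (G : WeightedDigraph n) (i j : Fin n) (h : i ≠ j) :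
    0 ≤ negLaplacian G i j := by
  rw [negLaplacian_of_ne G h]
  exact G.weight_nonneg i j

theorem act_negLaplacian {F : Type*} [NormedAddCommGroup F] [NormedSpace ℝ F]
    (G : WeightedDigraph n) (y : Fin n → F) (i : Fin n) :
    act (negLaplacian G) y i = -∑ j, G.weight i j • (y i - y j) := by
  simp [act, negLaplacian, sub_smul, smul_sub, Finset.sum_sub_distrib, Matrix.diagonal_apply,
    ite_smul, Finset.sum_smul]

/-- The six coefficients of a pure dual quaternion given by its two components. -/
noncomputable def vec6L : ℍ[ℝ] × ℍ[ℝ] →ₗ[ℝ] (Fin 3 ⊕ Fin 3 → ℝ) where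
  toFun z := Sum.elim (vec3 z.1) (vec3 z.2)
  map_add' z w := by
    have := vec3L.map_add z.1 w.1
    have := vec3L.map_add z.2 w.2
    simp only [vec3L_apply] at *
    ext (k | k) <;> simp [*]
  map_smul' c z := by
    have := vec3L.map_smul c z.1
    have := vec3L.map_smul c z.2
    simp only [vec3L_apply] at *
    ext (k | k) <;> simp [*]

theorem vec6L_apply (z : ℍ[ℝ] × ℍ[ℝ]) : vec6L z = Sum.elim (vec3 z.1) (vec3 z.2) := rfl

theorem vec6_dqlog_sub (x x' : DualQuat) :
    vec6 (dqlog x - dqlog x') = vec6L (logPair x - logPair x') := by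
  simp [vec6, vec6L_apply, dqlog_eq]

/-- The logarithms of the opinions of all agents. -/
noncomputable def logState (δ x : Fin n → DualQuat) (i : Fin n) : ℍ[ℝ] × ℍ[ℝ] :=
  logPair (center δ x i)

/-- The protocol drives the logarithms with the velocity `-L y`, `L` being the graph Laplacian. -/
theorem protocol_eq (G : WeightedDigraph n) (δ x : Fin n → DualQuat) (i : Fin n) :
    protocol G δ x i =
      vec8 (dexpVel (center δ x i) (act (negLaplacian G) (logState δ x) i) * δ i) := by
  have h : ∑ j, G.weight i j • vec6 (output δ x i - output δ x j) =
      -vec6L (act (negLaplacian G) (logState δ x) i) := by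
    rw [act_negLaplacian, map_neg, neg_neg, map_sum]
    simp only [map_smul, output, logState, vec6_dqlog_sub]
  rw [protocol, h, Matrix.mulVec_neg, neg_neg, ← Matrix.mulVec_mulVec, vec6L_apply, Q8_mulVec,
    hamMinus8_mulVec]

theorem re_act_eq_zero {P : Matrix (Fin n) (Fin n) ℝ} {y : Fin n → ℍ[ℝ]} (hy : ∀ j, (y j).re = 0)
    (i : Fin n) : (act P y i).re = 0 :=
  Finset.sum_induction _ (fun h : ℍ[ℝ] => h.re = 0) (fun a b ha hb => by simp [ha, hb]) rfl
    fun j _ => by simp [hy j]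

theorem act_fst (P : Matrix (Fin n) (Fin n) ℝ) (y : Fin n → ℍ[ℝ] × ℍ[ℝ]) (i : Fin n) :
    (act P y i).1 = act P (fun j => (y j).1) i := by
  simp [act, Prod.fst_sum]

theorem act_snd (P : Matrix (Fin n) (Fin n) ℝ) (y : Fin n → ℍ[ℝ] × ℍ[ℝ]) (i : Fin n) :
    (act P y i).2 = act P (fun j => (y j).2) i := by
  simp [act, Prod.snd_sum]

theorem center_mul_self {δ : Fin n → DualQuat} (hδ : ∀ i, IsUnitDualQuat (δ i))
    (x : Fin n → DualQuat) (i : Fin n) : center δ x i * δ i = x i := by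
  rw [center, mul_assoc, conj_mul_self (hδ i), mul_one]

theorem center_mul {δ : Fin n → DualQuat} (hδ : ∀ i, IsUnitDualQuat (δ i))
    (c : Fin n → DualQuat) (i : Fin n) : center δ (fun i => c i * δ i) i = c i := by
  have : δ i * conj (δ i) = 1 := hδ i
  rw [center, mul_assoc, this, mul_one]

/-- Along a trajectory, the logarithms solve the linear consensus equation. -/
theorem IsTrajectory.logState_eq_flow {G : WeightedDigraph n} {δ : Fin n → DualQuat}
    (hδ : ∀ i, IsUnitDualQuat (δ i)) {x : ℝ → Fin n → DualQuat} (hx : IsTrajectory G δ x)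
    {t : ℝ} (ht : 0 ≤ t) : logState δ (x t) = flow (negLaplacian G) t (logState δ (x 0)) := by
  refine eq_flow_of_hasDerivWithinAt (y := fun t => logState δ (x t)) (fun t ht i => ?_) ht
  have hdom (s : ℝ) (hs : 0 ≤ s) (j) : InLogDomain (center δ (x s) j) := ((hx s hs).1 j).2
  refine hasDerivWithinAt_logPair (x := fun s => center δ (x s) i) ht (fun s hs => hdom s hs i)
    ?_ ?_ ?_
  · rw [act_fst]
    exact re_act_eq_zero (fun j => logPair_fst_re _) i
  · rw [act_snd]
    exact re_act_eq_zero (fun j => logPair_snd_re (hdom t ht j)) i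
  · have h := (hx t ht).2 i
    rw [protocol_eq] at h
    have h2 := hasDerivWithinAt_vec8_mul_const h (conj (δ i))
    have hi : δ i * conj (δ i) = 1 := hδ i
    rw [mul_assoc, hi, mul_one] at h2
    exact h2

/-- The exponential of a solution of the linear consensus equation gives a trajectory: the
rotation vectors remain in the ball of radius `π` because they are averages of the initial ones. -/
theorem isTrajectory_dexp_flow (G : WeightedDigraph n) {δ : Fin n → DualQuat}
    (hδ : ∀ i, IsUnitDualQuat (δ i)) {y : Fin n → ℍ[ℝ] × ℍ[ℝ]} (hy1 : ∀ i, (y i).1.re = 0)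
    (hy2 : ∀ i, (y i).2.re = 0) (hpi : ∀ i, ‖(y i).1‖ < Real.pi) :
    IsTrajectory G δ fun t i => dexp (flow (negLaplacian G) t y i) * δ i := by
  have hre1 (t : ℝ) (i) : (flow (negLaplacian G) t y i).1.re = 0 := by
    rw [flow, act_fst]
    exact re_act_eq_zero hy1 i
  have hre2 (t : ℝ) (i) : (flow (negLaplacian G) t y i).2.re = 0 := by
    rw [flow, act_snd]
    exact re_act_eq_zero hy2 i
  have hlt {t : ℝ} (ht : 0 ≤ t) (i) : ‖(flow (negLaplacian G) t y i).1‖ < Real.pi := by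
    have : Nonempty (Fin n) := ⟨i⟩
    obtain ⟨j, hj⟩ := Finite.exists_max fun j => ‖(y j).1‖
    have := norm_act_sub_le (c := (0 : ℍ[ℝ])) (exp_smul_mem_rowStochastic (negLaplacian_row_sum G)
      (negLaplacian_nonneg_of_ne G) ht) (y := fun j => (y j).1) (by simpa using hj) i
    rw [sub_zero] at this
    rw [flow, act_fst]
    exact this.trans_lt (hpi j)
  intro t ht
  have hc (i) : center δ (fun i => dexp (flow (negLaplacian G) t y i) * δ i) i =
      dexp (flow (negLaplacian G) t y i) := center_mul hδ _ i
  refine ⟨fun i => ⟨(isUnitDualQuat_dexp (hre1 t i) (hre2 t i)).mul (hδ i), ?_⟩, fun i => ?_⟩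
  · rw [hc]
    exact inLogDomain_dexp (hre1 t i) (hre2 t i) (hlt ht i)
  · have hls : logState δ (fun i => dexp (flow (negLaplacian G) t y i) * δ i) =
        flow (negLaplacian G) t y := by
      ext1 j
      rw [logState, hc, logPair_dexp (hre1 t j) (hlt ht j)]
    rw [protocol_eq, hc, hls]
    refine hasDerivWithinAt_vec8_mul_const ?_ _
    refine hasDerivWithinAt_dexp (fun s => hre1 s i) (hlt ht i) ?_
      (hasDerivAt_flow _ y t i).hasDerivWithinAt
    rw [act_snd]
    exact re_act_eq_zero (hre2 t) i

/-! ### Formation and output consensus -/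

theorem exists_isTrajectory (G : WeightedDigraph n) {δ : Fin n → DualQuat}
    (hδ : ∀ i, IsUnitDualQuat (δ i)) {x₀ : Fin n → DualQuat} (h0 : IsConfiguration δ x₀) :
    ∃ x : ℝ → Fin n → DualQuat, IsTrajectory G δ x ∧ x 0 = x₀ := by
  refine ⟨_, isTrajectory_dexp_flow G hδ (y := logState δ x₀) (fun i => logPair_fst_re _)
    (fun i => logPair_snd_re (h0 i).2) (fun i => norm_logPair_fst_lt (h0 i).2), ?_⟩
  ext1 i
  simp only [flow_zero]
  rw [logState, dexp_logPair (h0 i).2, center_mul_self hδ]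

/-- With a directed spanning tree, the logarithms of all opinions tend to a common limit. -/
theorem IsTrajectory.exists_tendsto_logState {G : WeightedDigraph n} {δ : Fin n → DualQuat}
    (hδ : ∀ i, IsUnitDualQuat (δ i)) (hG : HasDirectedSpanningTree G.toDigraph)
    {x : ℝ → Fin n → DualQuat} (hx : IsTrajectory G δ x) :
    ∃ c, ∀ i, Tendsto (fun t => logState δ (x t) i) atTop (𝓝 c) := by
  obtain ⟨r, hr⟩ := hG.exists_root
  obtain ⟨c, hc⟩ := exists_tendsto_flow (negLaplacian_row_sum G) (negLaplacian_nonneg_of_ne G)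
    (r := r) (fun i => Relation.ReflTransGen.mono (fun u v huv => by
      have hne : u ≠ v := by
        rintro rfl
        exact G.loopless _ huv
      refine ⟨hne, ?_⟩
      rw [negLaplacian_of_ne G hne.symm]
      exact G.weight_pos v u huv) _ _ (hr i)) (logState δ (x 0))
  refine ⟨c, fun i => (hc i).congr' ?_⟩
  filter_upwards [eventually_ge_atTop 0] with t ht
  rw [hx.logState_eq_flow hδ ht]

theorem IsTrajectory.reachesFormation {G : WeightedDigraph n} {δ : Fin n → DualQuat}
    (hδ : ∀ i, IsUnitDualQuat (δ i)) (hG : HasDirectedSpanningTree G.toDigraph)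
    {x : ℝ → Fin n → DualQuat} (hx : IsTrajectory G δ x) : ReachesFormation δ x := by
  obtain ⟨c, hc⟩ := hx.exists_tendsto_logState hδ hG
  obtain ⟨r, -⟩ := hG.exists_root
  have hdom {t : ℝ} (ht : 0 ≤ t) (i) : InLogDomain (center δ (x t) i) := ((hx t ht).1 i).2
  have h1 : c.1.re = 0 := by
    refine tendsto_nhds_unique (((Quaternion.continuous_re.comp continuous_fst).tendsto c).comp
      (hc r)) (tendsto_const_nhds.congr fun t => ?_)
    exact (logPair_fst_re _).symm
  have h2 : c.2.re = 0 := by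
    refine tendsto_nhds_unique (((Quaternion.continuous_re.comp continuous_snd).tendsto c).comp
      (hc r)) (tendsto_const_nhds.congr' ?_)
    filter_upwards [eventually_ge_atTop 0] with t ht
    exact (logPair_snd_re (hdom ht r)).symm
  refine ⟨dexp c, isUnitDualQuat_dexp h1 h2, fun i => ?_⟩
  refine (((continuous_dexp.tendsto c).comp (hc i)).mul_const (δ i)).congr' ?_
  filter_upwards [eventually_ge_atTop 0] with t ht
  rw [Function.comp_apply, logState, dexp_logPair (hdom ht i), center_mul_self hδ]

theorem IsTrajectory.outputConsensus {G : WeightedDigraph n} {δ : Fin n → DualQuat}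
    (hδ : ∀ i, IsUnitDualQuat (δ i)) (hG : HasDirectedSpanningTree G.toDigraph)
    {x : ℝ → Fin n → DualQuat} (hx : IsTrajectory G δ x) : OutputConsensus δ x := by
  obtain ⟨c, hc⟩ := hx.exists_tendsto_logState hδ hG
  have hcont : Continuous fun z : ℍ[ℝ] × ℍ[ℝ] =>
      (TrivSqZeroExt.inl z.1 + TrivSqZeroExt.inr z.2 : DualQuat) :=
    (TrivSqZeroExt.continuous_inl.comp continuous_fst).add
      (TrivSqZeroExt.continuous_inr.comp continuous_snd)
  intro i j
  have := ((hcont.tendsto c).comp (hc i)).sub ((hcont.tendsto c).comp (hc j))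
  rw [sub_self] at this
  exact this

/-- Without a directed spanning tree there are two groups of agents that no other agent
influences. If they start with opinions that differ by a translation, and without rotation, then
each group stays at rest. -/
theorem exists_isTrajectory_constant (hn : 0 < n) {G : WeightedDigraph n} {δ : Fin n → DualQuat}
    (hδ : ∀ i, IsUnitDualQuat (δ i)) (hG : ¬ HasDirectedSpanningTree G.toDigraph) :
    ∃ (x : ℝ → Fin n → DualQuat) (i j : Fin n) (a b : DualQuat), IsTrajectory G δ x ∧
      dqlog a ≠ dqlog b ∧ (∀ t, center δ (x t) i = a) ∧ ∀ t, center δ (x t) j = b := by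
  classical
  have : Nonempty (Fin n) := ⟨⟨0, hn⟩⟩
  obtain ⟨S, T, ⟨i, hi⟩, ⟨j, hj⟩, hdisj, hS, hT⟩ :=
    exists_disjoint_closed_of_not_hasDirectedSpanningTree hG
  let e : ℍ[ℝ] := pure3 ![1, 0, 0]
  let y : Fin n → ℍ[ℝ] × ℍ[ℝ] := fun k => (0, if k ∈ T then e else 0)
  have hzero {U : Set (Fin n)} (hU : ∀ i ∈ U, ∀ j, G.Adj j i → j ∈ U) :
      ∀ i ∈ U, ∀ j ∉ U, negLaplacian G i j = 0 := by
    intro i hi j hj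
    rw [negLaplacian_of_ne G (by rintro rfl; exact hj hi)]
    exact G.weight_eq_zero i j fun h => hj (hU i hi j h)
  have hrow := negLaplacian_row_sum G
  refine ⟨_, i, j, dexp (0, 0), dexp (0, e), isTrajectory_dexp_flow G hδ (y := y)
    (fun k => rfl) (fun k => ?_) (fun k => by simpa [y] using Real.pi_pos), ?_,
    fun t => ?_, fun t => ?_⟩
  · by_cases hk : k ∈ T <;> simp [y, hk, e, re_pure3]
  · have hpi : ‖(0 : ℍ[ℝ])‖ < Real.pi := by simpa using Real.pi_pos
    intro h
    rw [dqlog_eq, dqlog_eq, logPair_dexp rfl hpi, logPair_dexp rfl hpi] at h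
    have h2 := congrArg (fun d : DualQuat => d.snd.imI) h
    simp [e, imI_pure3] at h2
  · rw [center_mul hδ, flow_eq_const hrow (hzero hS) (c := (0, 0)) (fun k hk => ?_) t hi]
    simp [y, Set.disjoint_left.1 hdisj hk]
  · rw [center_mul hδ, flow_eq_const hrow (hzero hT) (c := (0, e)) (fun k hk => ?_) t hj]
    simp [y, hk]

end PoseFormation

theorem mainTheorem2 (n : ℕ) (hn : 0 < n) (G : PoseFormation.WeightedDigraph n)
    (δ : Fin n → PoseFormation.DualQuat) (hδ : ∀ i, PoseFormation.IsUnitDualQuat (δ i)) :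
    (∀ x₀ : Fin n → PoseFormation.DualQuat, PoseFormation.IsConfiguration δ x₀ →
      ∃ x : ℝ → Fin n → PoseFormation.DualQuat,
        PoseFormation.IsTrajectory G δ x ∧ x 0 = x₀) ∧
    ((∀ x : ℝ → Fin n → PoseFormation.DualQuat, PoseFormation.IsTrajectory G δ x →
        PoseFormation.ReachesFormation δ x) ↔
      PoseFormation.HasDirectedSpanningTree G.toDigraph) ∧
    ((∀ x : ℝ → Fin n → PoseFormation.DualQuat, PoseFormation.IsTrajectory G δ x →
        PoseFormation.OutputConsensus δ x) ↔
      PoseFormation.HasDirectedSpanningTree G.toDigraph) := by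
  refine ⟨fun x₀ h0 => PoseFormation.exists_isTrajectory G hδ h0,
    ⟨fun h => ?_, fun hG x hx => hx.reachesFormation hδ hG⟩,
    ⟨fun h => ?_, fun hG x hx => hx.outputConsensus hδ hG⟩⟩
  · by_contra hG
    obtain ⟨x, i, j, a, b, hx, hab, hi, hj⟩ :=
      PoseFormation.exists_isTrajectory_constant hn hδ hG
    obtain ⟨c, -, hc⟩ := h x hx
    -- In the limit all opinions agree, whereas those of `i` and `j` are constantly different.
    have key (k : Fin n) :
        Tendsto (fun t => PoseFormation.center δ (x t) k) atTop (𝓝 c) := by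
      have h1 := (hc k).mul_const (PoseFormation.conj (δ k))
      have h2 : δ k * PoseFormation.conj (δ k) = 1 := hδ k
      rwa [mul_assoc, h2, mul_one] at h1
    have hi' := key i
    have hj' := key j
    simp only [hi, hj] at hi' hj'
    exact hab (congrArg _ ((tendsto_nhds_unique tendsto_const_nhds hi').trans
      (tendsto_nhds_unique tendsto_const_nhds hj').symm))
  · by_contra hG
    obtain ⟨x, i, j, a, b, hx, hab, hi, hj⟩ :=
      PoseFormation.exists_isTrajectory_constant hn hδ hG
    have h1 := h x hx i j
    simp only [PoseFormation.output, hi, hj] at h1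
    exact hab (sub_eq_zero.1 (tendsto_nhds_unique tendsto_const_nhds h1))
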